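/- Let $D=\{|z|<1\}$, let $T=\{|\zeta|=1\}$, let $m$ be the normalized Lebesgue measure on $T$ ($m(T)=1$), and for $g$ analytic in $D$ put $\|g\|_{H^1}=\sup_{0\le r<1}\int_T|g(r\zeta)|\,dm(\zeta)$; $g\in H^1$ means that this is finite. Theorem 1. Let $f$ be analytic in $D$ with $f'\in H^1$. Then the radial limit $f(\xi):=\lim_{r\to1^-}f(r\xi)$ exists in $\mathbb{C}$ at every $\xi\in T$, and with these boundary values, for every $\eta\in T$, the following integrand is integrable on $T$ and $$\int_T\frac{|f(\zeta\eta)-f(\overline{\zeta}\eta)|}{|1-\zeta|}\,dm(\zeta)\le\pi\,\|f'\|_{H^1}.$$ -/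

import Mathlib

open MeasureTheory Filter Topology
open scoped ENNReal

noncomputable section

instance circleMeasurableSpace : MeasurableSpace Circle := borel Circle

instance circleBorelSpace : BorelSpace Circle := ⟨rfl⟩

/-- Normalized Lebesgue (arc length) measure `m` on the unit circle `T`: the image of the
normalized Lebesgue measure on `(-π, π]` under `t ↦ exp (i t)`. -/
def circleMeasure : Measure Circle :=
  Measure.map Circle.exp
    (ENNReal.ofReal (2 * Real.pi)⁻¹ • volume.restrict (Set.Ioc (-Real.pi) Real.pi))

/-- The `H¹` norm `sup_{0 ≤ r < 1} ∫_T |g (r ζ)| dm(ζ)`, with values in `[0, ∞]`. -/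
def hardyOneNorm (g : ℂ → ℂ) : ℝ≥0∞ :=
  ⨆ r ∈ Set.Ico (0 : ℝ) 1, ∫⁻ ζ : Circle, ‖g ((r : ℂ) * (ζ : ℂ))‖ₑ ∂circleMeasure

/-- Membership in the Hardy space `H¹`: `g` is analytic in the open unit disc and its `H¹` norm
is finite. -/
def MemHardyOne (g : ℂ → ℂ) : Prop :=
  AnalyticOnNhd ℂ g (Metric.ball 0 1) ∧ hardyOneNorm g < ∞

/-- The boundary value of `f` at a point `ξ` of the unit circle, as the radial limit
`lim_{r → 1-} f (r ξ)` (meaningful where this limit exists). -/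
def radialLimit (f : ℂ → ℂ) (ξ : Circle) : ℂ :=
  limUnder (𝓝[<] (1 : ℝ)) (fun r : ℝ => f ((r : ℂ) * (ξ : ℂ)))

end

/-! Put `F z = f (ρ z η)` with `ρ < 1`, analytic on a disc larger than `D`, and move to the upper
half plane by `cayley`. Real `x` and `-x` go to `ζ` and its conjugate, and `m` becomes `dx / (π (1 +
x²))`. The points over `R` and `-R` are joined by the image of the semicircle `|w| = R`, so `|F(ζ) -
F(ζ̄)|` is at most the integral of `|F'|` along that arc (`enorm_sub_le_lintegral_semicircle`).
Integrating over `R > 0` and exchanging the integrals leaves, for each angle `φ`, an integral along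
the ray `arg w = φ`.

On a ray, Hardy's convexity estimate `lintegral_ray_le` applies: the integral of `|F'| |cayley'|` is
at most `2φ` times the mass of `|F'|` on one half of `T` plus `2(π - φ)` times the mass on the other
half. Both constants integrate over `(0, π)` to `π²`. With the factor `1 / (2π)` from the measure
and the denominator, and a factor 2 for the two signs of `x`, the constant is `π`.

The ray `φ = π/2` is a diameter, which gives the Fejér–Riesz inequality: `f'` is integrable along
every radius, so every radial limit exists. Fatou's lemma then lets `ρ → 1`. -/

/-! ### Poisson majorant for the modulus of an analytic function. -/

theorem norm_le_poisson {h : ℂ → ℂ} {r : ℝ} (hr : 1 < r)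
    (hh : DifferentiableOn ℂ h (Metric.ball 0 r)) {z : ℂ} (hz : ‖z‖ < 1) :
    ‖h z‖ ≤ (2 * Real.pi)⁻¹ * ∫ t in (-Real.pi)..Real.pi,
      (1 - ‖z‖ ^ 2) / ‖Complex.exp (t * Complex.I) - z‖ ^ 2 * ‖h (Complex.exp (t * Complex.I))‖ := by
  have hden : ∀ u : ℂ, ‖u‖ ≤ 1 → 1 - (starRingEnd ℂ) z * u ≠ 0 := by
    intro u hu h0
    have h1 : ‖(starRingEnd ℂ) z * u‖ = 1 := by
      rw [← sub_eq_zero.mp h0, norm_one]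
    rw [norm_mul, RCLike.norm_conj] at h1
    nlinarith [norm_nonneg z, norm_nonneg u]
  have hone : 0 < 1 - ‖z‖ ^ 2 := by nlinarith [norm_nonneg z]
  -- The factor multiplying `h` equals 1 at `u = z`. On the unit circle `|1 - z̄u| = |u - z|`, so it
  -- turns the Cauchy kernel into the Poisson kernel in modulus.
  set F : ℂ → ℂ := fun u => h u * ((1 - ‖z‖ ^ 2 : ℝ) : ℂ) / (1 - (starRingEnd ℂ) z * u) with hF
  have hsub : Metric.closedBall (0 : ℂ) 1 ⊆ Metric.ball 0 r := Metric.closedBall_subset_ball hr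
  have hFd : DiffContOnCl ℂ F (Metric.ball 0 1) := by
    apply DifferentiableOn.diffContOnCl
    rw [closure_ball _ one_ne_zero]
    apply DifferentiableOn.div
    · exact (hh.mono hsub).mul_const _
    · fun_prop
    · intro u hu
      exact hden u (by simpa using hu)
  have hc := hFd.two_pi_i_inv_smul_circleIntegral_sub_inv_smul (w := z) (by simpa using hz)
  have hFz : F z = h z := by
    have h1 : (1 : ℂ) - (starRingEnd ℂ) z * z = ((1 - ‖z‖ ^ 2 : ℝ) : ℂ) := by
      rw [mul_comm, Complex.mul_conj, Complex.normSq_eq_norm_sq]; push_cast; ring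
    simp only [hF]
    rw [h1, mul_div_assoc, div_self (by exact_mod_cast hone.ne'), mul_one]
  set p : ℝ → ℝ := fun t =>
    (1 - ‖z‖ ^ 2) / ‖Complex.exp (t * Complex.I) - z‖ ^ 2 * ‖h (Complex.exp (t * Complex.I))‖ with hp
  have hper : Function.Periodic p (2 * Real.pi) := by
    intro t
    have : Complex.exp (((t + 2 * Real.pi : ℝ) : ℂ) * Complex.I) = Complex.exp (t * Complex.I) := by
      rw [← Complex.exp_periodic (t * Complex.I)]; congr 1; push_cast; ring
    simp only [hp, this]
  have hpi : ∫ t in (-Real.pi)..Real.pi, p t = ∫ t in (0:ℝ)..(2 * Real.pi), p t := by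
    have := hper.intervalIntegral_add_eq (-Real.pi) 0
    rw [zero_add] at this
    rw [← this]; congr 1; ring
  have hnorm : ‖∮ u in C(0, 1), (u - z)⁻¹ • F u‖ ≤ ∫ t in (0:ℝ)..(2 * Real.pi), p t := by
    rw [circleIntegral]
    refine (intervalIntegral.norm_integral_le_integral_norm (by positivity)).trans_eq ?_
    apply intervalIntegral.integral_congr
    intro t _
    have h1 : circleMap 0 1 t = Complex.exp (t * Complex.I) := by simp [circleMap]
    have hu : ‖Complex.exp (t * Complex.I)‖ = 1 := Complex.norm_exp_ofReal_mul_I t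
    have h2 : ‖1 - (starRingEnd ℂ) z * Complex.exp (t * Complex.I)‖
        = ‖Complex.exp (t * Complex.I) - z‖ := by
      generalize Complex.exp (t * Complex.I) = u at hu
      have h3 : (starRingEnd ℂ) (1 - (starRingEnd ℂ) z * u) * u = u - z := by
        have h4 : (starRingEnd ℂ) u * u = 1 := by
          rw [mul_comm, Complex.mul_conj, Complex.normSq_eq_norm_sq, hu]; simp
        simp only [map_sub, map_one, map_mul, Complex.conj_conj]
        linear_combination (-z) * h4
      rw [← h3, norm_mul, hu, RCLike.norm_conj, mul_one]
    simp only [deriv_circleMap, h1, hF, hp, norm_smul, norm_mul, norm_div, norm_inv, hu, h2,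
      Complex.norm_real, Complex.norm_I, Real.norm_eq_abs, abs_of_pos hone]
    rw [mul_one, one_mul]
    ring
  rw [hpi, ← hFz, ← hc, norm_smul]
  have : ‖(2 * (Real.pi : ℂ) * Complex.I)⁻¹‖ = (2 * Real.pi)⁻¹ := by
    simp [abs_of_pos Real.pi_pos]
  rw [this]
  gcongr

/-! ### Half-plane coordinates: `t = 2 arctan x` and the Cayley transform. -/

theorem lintegral_Ioo_eq_lintegral_arctan (u : ℝ → ℝ≥0∞) :
    ∫⁻ t in Set.Ioo (-Real.pi) Real.pi, u t
      = ∫⁻ x : ℝ, ENNReal.ofReal (2 / (1 + x ^ 2)) * u (2 * Real.arctan x) := by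
  have himg : (fun x : ℝ => 2 * Real.arctan x) '' Set.univ = Set.Ioo (-Real.pi) Real.pi := by
    ext t
    simp only [Set.image_univ, Set.mem_range, Set.mem_Ioo]
    constructor
    · rintro ⟨x, rfl⟩
      constructor <;> linarith [Real.neg_pi_div_two_lt_arctan x, Real.arctan_lt_pi_div_two x]
    · rintro ⟨h1, h2⟩
      exact ⟨Real.tan (t / 2), by rw [Real.arctan_tan (by linarith) (by linarith)]; ring⟩
  have := lintegral_image_eq_lintegral_abs_deriv_mul (s := Set.univ)
    (f := fun x : ℝ => 2 * Real.arctan x) (f' := fun x => 2 * (1 / (1 + x ^ 2)))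
    MeasurableSet.univ (fun x _ => ((Real.hasDerivAt_arctan x).const_mul 2).hasDerivWithinAt)
    (fun x _ y _ hxy => Real.arctan_injective (by simpa using hxy)) u
  rw [himg, Measure.restrict_univ] at this
  rw [this]
  congr! 3 with x
  rw [abs_of_nonneg (by positivity)]; congr 1; ring

/-- The Cayley transform, from the upper half plane onto the unit disc, sending `0` to `1`. -/
noncomputable def cayley (w : ℂ) : ℂ := (1 + Complex.I * w) / (1 - Complex.I * w)

theorem one_sub_I_mul_ne_zero {w : ℂ} (hw : 0 ≤ w.im) : 1 - Complex.I * w ≠ 0 := by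
  intro h
  have := congrArg Complex.re h
  simp at this
  linarith

theorem exp_two_arctan (x : ℝ) :
    Complex.exp ((2 * Real.arctan x : ℝ) * Complex.I) = cayley x := by
  have h0 : (0:ℝ) < 1 + x ^ 2 := by positivity
  have h1 : Complex.exp ((2 * Real.arctan x : ℝ) * Complex.I)
      = ((Real.cos (Real.arctan x) : ℂ) + Real.sin (Real.arctan x) * Complex.I) ^ 2 := by
    rw [Complex.ofReal_cos, Complex.ofReal_sin, ← Complex.exp_mul_I, ← Complex.exp_nat_mul]
    congr 1; push_cast; ring
  have h2 : ((√(1 + x ^ 2) : ℝ) : ℂ) ^ 2 = 1 + x ^ 2 := by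
    rw [← Complex.ofReal_pow, Real.sq_sqrt h0.le]; push_cast; ring
  have h3 : ((√(1 + x ^ 2) : ℝ) : ℂ) ≠ 0 := by exact_mod_cast (Real.sqrt_pos.mpr h0).ne'
  have h4 : (1 : ℂ) - Complex.I * x ≠ 0 := one_sub_I_mul_ne_zero (by simp)
  rw [h1, Real.cos_arctan, Real.sin_arctan, cayley]
  push_cast
  rw [div_add' _ _ _ h3, div_pow, h2, div_eq_div_iff (by exact_mod_cast h0.ne') h4]
  field_simp
  linear_combination (-x ^ 2 * (1 + Complex.I * x)) * Complex.I_sq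

theorem hasDerivAt_cayley {w : ℂ} (hw : 0 ≤ w.im) :
    HasDerivAt cayley (2 * Complex.I / (1 - Complex.I * w) ^ 2) w := by
  have h := one_sub_I_mul_ne_zero hw
  have h1 : HasDerivAt (fun w : ℂ => Complex.I * w) Complex.I w := by
    simpa using (hasDerivAt_id w).const_mul Complex.I
  refine ((h1.const_add 1).div (h1.const_sub 1) h).congr_deriv ?_
  congr 1
  ring

theorem one_sub_cayley_sq {w : ℂ} (hw : 0 ≤ w.im) :
    1 - cayley w ^ 2 = -4 * Complex.I * w / (1 - Complex.I * w) ^ 2 := by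
  have h := one_sub_I_mul_ne_zero hw
  rw [cayley]; field_simp; ring

theorem one_sub_cayley {w : ℂ} (hw : 0 ≤ w.im) :
    1 - cayley w = -2 * Complex.I * w / (1 - Complex.I * w) := by
  have h := one_sub_I_mul_ne_zero hw
  rw [cayley]; field_simp; ring

theorem cayley_sub_cayley {w v : ℂ} (hw : 0 ≤ w.im) (hv : 0 ≤ v.im) :
    cayley v - cayley w
      = 2 * Complex.I * (v - w) / ((1 - Complex.I * v) * (1 - Complex.I * w)) := by
  have h := one_sub_I_mul_ne_zero hw
  have h' := one_sub_I_mul_ne_zero hv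
  rw [cayley, cayley]; field_simp; ring

theorem one_sub_norm_cayley_sq {w : ℂ} (hw : 0 ≤ w.im) :
    1 - ‖cayley w‖ ^ 2 = 4 * w.im / ‖1 - Complex.I * w‖ ^ 2 := by
  have h : ‖1 - Complex.I * w‖ ^ 2 ≠ 0 := by simpa using one_sub_I_mul_ne_zero hw
  rw [cayley, norm_div, div_pow, eq_div_iff h, sub_mul, div_mul_cancel₀ _ h]
  simp only [← Complex.normSq_eq_norm_sq, Complex.normSq_apply]
  simp
  ring

theorem norm_cayley_lt_one {w : ℂ} (hw : 0 < w.im) : ‖cayley w‖ < 1 := by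
  have h := one_sub_norm_cayley_sq hw.le
  have h1 : 0 < ‖1 - Complex.I * w‖ := norm_pos_iff.mpr (one_sub_I_mul_ne_zero hw.le)
  have h2 : 0 < 4 * w.im / ‖1 - Complex.I * w‖ ^ 2 := by positivity
  nlinarith [norm_nonneg (cayley w)]

theorem norm_cayley_le_one {w : ℂ} (hw : 0 ≤ w.im) : ‖cayley w‖ ≤ 1 := by
  have h := one_sub_norm_cayley_sq hw
  have h2 : 0 ≤ 4 * w.im / ‖1 - Complex.I * w‖ ^ 2 := by positivity
  nlinarith [norm_nonneg (cayley w)]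

theorem norm_one_sub_I_mul_ofReal_sq (x : ℝ) : ‖1 - Complex.I * x‖ ^ 2 = 1 + x ^ 2 := by
  rw [← Complex.normSq_eq_norm_sq, Complex.normSq_apply]; simp; ring

/-- The Poisson kernel is conformally covariant, and the weight `|1 - z²|` absorbs the leftover
factor `1 + x²`. Divided by `|w|`, the result is homogeneous of degree -1 in `(x, w)`. -/
theorem poisson_kernel_cayley {w : ℂ} (hw : 0 < w.im) (x : ℝ) :
    (1 - ‖cayley w‖ ^ 2) / ‖cayley x - cayley w‖ ^ 2 * ‖1 - cayley x ^ 2‖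
      = 4 * |x| * w.im / ‖x - w‖ ^ 2 := by
  have h1 : ‖1 - Complex.I * w‖ ≠ 0 := by simpa using one_sub_I_mul_ne_zero hw.le
  have h2 : ‖1 - Complex.I * (x : ℂ)‖ ≠ 0 := by
    simpa using one_sub_I_mul_ne_zero (w := (x : ℂ)) (by simp)
  have h3 : ‖(x : ℂ) - w‖ ≠ 0 := by
    rw [norm_ne_zero_iff, sub_ne_zero]; rintro rfl; simp at hw
  rw [one_sub_norm_cayley_sq hw.le, cayley_sub_cayley hw.le (by simp), one_sub_cayley_sq (by simp)]
  simp only [norm_mul, norm_div, norm_pow, norm_neg, Complex.norm_I, Complex.norm_ofNat,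
    Complex.norm_real, Real.norm_eq_abs]
  field_simp
  ring

/-! ### Hardy's estimate along rays. -/

/-- By homogeneity the value cannot depend on `x`. An explicit arctangent primitive runs from `2φ -
π` at `R = 0` to `π` at infinity. -/
theorem lintegral_ray_kernel {φ : ℝ} (hφ : φ ∈ Set.Ioo 0 Real.pi) {x : ℝ} (hx : 0 < x) :
    ∫⁻ R in Set.Ioi (0 : ℝ),
      ENNReal.ofReal (2 * x * Real.sin φ / (R ^ 2 - 2 * R * x * Real.cos φ + x ^ 2))
      = ENNReal.ofReal (2 * (Real.pi - φ)) := by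
  have hs : 0 < Real.sin φ := Real.sin_pos_of_mem_Ioo hφ
  have hsc := Real.sin_sq_add_cos_sq φ
  have hden : ∀ R : ℝ, R ^ 2 - 2 * R * x * Real.cos φ + x ^ 2
      = (R - x * Real.cos φ) ^ 2 + (x * Real.sin φ) ^ 2 := by
    intro R; linear_combination (-x ^ 2) * hsc
  have hpos : ∀ R : ℝ, 0 < R ^ 2 - 2 * R * x * Real.cos φ + x ^ 2 := by
    intro R; rw [hden]; positivity
  set F : ℝ → ℝ := fun R => 2 * Real.arctan ((R - x * Real.cos φ) / (x * Real.sin φ)) with hF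
  have hd : ∀ R : ℝ, HasDerivAt F
      (2 * x * Real.sin φ / (R ^ 2 - 2 * R * x * Real.cos φ + x ^ 2)) R := by
    intro R
    have h1 : HasDerivAt (fun R : ℝ => (R - x * Real.cos φ) / (x * Real.sin φ))
        (1 / (x * Real.sin φ)) R := ((hasDerivAt_id R).sub_const _).div_const _
    refine (h1.arctan.const_mul 2).congr_deriv ?_
    rw [hden]
    field_simp
    ring
  have hlim : Tendsto F atTop (𝓝 Real.pi) := by
    have h1 : Tendsto (fun R : ℝ => (R - x * Real.cos φ) / (x * Real.sin φ)) atTop atTop :=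
      (tendsto_atTop_add_const_right _ _ tendsto_id).atTop_div_const (by positivity)
    have h2 := ((Real.tendsto_arctan_atTop.mono_right nhdsWithin_le_nhds).comp h1).const_mul 2
    rw [mul_div_cancel₀ Real.pi two_ne_zero] at h2
    exact h2
  have h0 : F 0 = 2 * φ - Real.pi := by
    have h1 : (0 - x * Real.cos φ) / (x * Real.sin φ) = Real.tan (φ - Real.pi / 2) := by
      rw [Real.tan_eq_sin_div_cos, Real.sin_sub_pi_div_two, Real.cos_sub_pi_div_two]
      field_simp
      ring
    simp only [hF]
    rw [h1, Real.arctan_tan (by linarith [hφ.1]) (by linarith [hφ.2])]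
    ring
  have hnn : ∀ R ∈ Set.Ioi (0:ℝ),
      0 ≤ 2 * x * Real.sin φ / (R ^ 2 - 2 * R * x * Real.cos φ + x ^ 2) :=
    fun R _ => div_nonneg (by positivity) (hpos R).le
  have hint := integrableOn_Ioi_deriv_of_nonneg (hd 0).continuousAt.continuousWithinAt
    (fun R _ => hd R) hnn hlim
  have hval := integral_Ioi_of_hasDerivAt_of_nonneg (hd 0).continuousAt.continuousWithinAt
    (fun R _ => hd R) hnn hlim
  rw [← ofReal_integral_eq_lintegral_ofReal hint
    ((ae_restrict_iff' measurableSet_Ioi).mpr (ae_of_all _ hnn)), hval, h0]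
  congr 1; ring

theorem lintegral_ray_kernel_neg {φ : ℝ} (hφ : φ ∈ Set.Ioo 0 Real.pi) {x : ℝ} (hx : x < 0) :
    ∫⁻ R in Set.Ioi (0 : ℝ),
      ENNReal.ofReal (2 * (-x) * Real.sin φ / (R ^ 2 - 2 * R * x * Real.cos φ + x ^ 2))
      = ENNReal.ofReal (2 * φ) := by
  have := lintegral_ray_kernel (φ := Real.pi - φ) ⟨by linarith [hφ.2], by linarith [hφ.1]⟩
    (neg_pos.mpr hx)
  rw [Real.sin_pi_sub, Real.cos_pi_sub] at this
  convert this using 4 <;> ring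

theorem enorm_le_lintegral_poisson {h : ℂ → ℂ} {r : ℝ} (hr : 1 < r)
    (hh : DifferentiableOn ℂ h (Metric.ball 0 r)) {z : ℂ} (hz : ‖z‖ < 1) :
    ‖h z‖ₑ ≤ ∫⁻ x : ℝ, ENNReal.ofReal ((Real.pi * (1 + x ^ 2))⁻¹) *
      ENNReal.ofReal ((1 - ‖z‖ ^ 2) / ‖cayley x - z‖ ^ 2 * ‖h (cayley x)‖) := by
  have hone : 0 ≤ 1 - ‖z‖ ^ 2 := by nlinarith [norm_nonneg z]
  have h1 := norm_le_poisson hr hh hz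
  rw [← ofReal_norm]
  refine (ENNReal.ofReal_le_ofReal h1).trans ?_
  rw [ENNReal.ofReal_mul (by positivity),
    intervalIntegral.integral_of_le (by linarith [Real.pi_pos])]
  refine (mul_le_mul_right ((Real.ofReal_le_enorm _).trans
    (enorm_integral_le_lintegral_enorm _)) _).trans_eq ?_
  rw [Measure.restrict_congr_set Ioo_ae_eq_Ioc.symm, lintegral_Ioo_eq_lintegral_arctan,
    ← lintegral_const_mul' _ _ ENNReal.ofReal_ne_top]
  congr 1 with x
  rw [exp_two_arctan, ← mul_assoc, ← ENNReal.ofReal_mul (by positivity),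
    Real.enorm_of_nonneg (by positivity)]
  congr 2
  field_simp

/-- The Poisson bound is applied to `(1 - z²) g(z)` because `|cayley' w| = |1 - z²| / (2|w|)` at `z
= cayley w`. -/
theorem enorm_cayley_le {g : ℂ → ℂ} {r : ℝ} (hr : 1 < r)
    (hg : DifferentiableOn ℂ g (Metric.ball 0 r)) {w : ℂ} (hw : 0 < w.im) :
    ENNReal.ofReal (2 / ‖1 - Complex.I * w‖ ^ 2) * ‖g (cayley w)‖ₑ
      ≤ ∫⁻ x : ℝ, ENNReal.ofReal (2 * |x| * (w.im / ‖w‖) / ‖x - w‖ ^ 2) *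
        (ENNReal.ofReal ((Real.pi * (1 + x ^ 2))⁻¹) * ‖g (cayley x)‖ₑ) := by
  have hh : DifferentiableOn ℂ (fun z => (1 - z ^ 2) * g z) (Metric.ball 0 r) :=
    DifferentiableOn.mul (by fun_prop) hg
  have h1 := enorm_le_lintegral_poisson hr hh (norm_cayley_lt_one hw)
  have hw0 : 0 < ‖w‖ := norm_pos_iff.mpr (by rintro rfl; simp at hw)
  have hd : 0 < ‖1 - Complex.I * w‖ := norm_pos_iff.mpr (one_sub_I_mul_ne_zero hw.le)
  have h2 : ENNReal.ofReal (2 / ‖1 - Complex.I * w‖ ^ 2) * ‖g (cayley w)‖ₑ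
      = ENNReal.ofReal ((2 * ‖w‖)⁻¹) * ‖(1 - cayley w ^ 2) * g (cayley w)‖ₑ := by
    rw [enorm_mul, ← mul_assoc, ← ofReal_norm (1 - cayley w ^ 2),
      ← ENNReal.ofReal_mul (by positivity), one_sub_cayley_sq hw.le]
    congr 2
    simp only [norm_mul, norm_div, norm_pow, norm_neg, Complex.norm_I, Complex.norm_ofNat]
    field_simp
    norm_num
  rw [h2]
  refine (mul_le_mul_right h1 _).trans_eq ?_
  rw [← lintegral_const_mul' _ _ ENNReal.ofReal_ne_top]
  congr 1 with x
  have h3 : ENNReal.ofReal (2 * |x| * (w.im / ‖w‖) / ‖x - w‖ ^ 2)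
      = ENNReal.ofReal ((2 * ‖w‖)⁻¹) * ENNReal.ofReal (4 * |x| * w.im / ‖x - w‖ ^ 2) := by
    rw [← ENNReal.ofReal_mul (by positivity)]
    congr 1
    rw [mul_inv]
    ring
  rw [norm_mul, ← mul_assoc _ ‖1 - cayley x ^ 2‖, poisson_kernel_cayley hw x,
    ENNReal.ofReal_mul (by positivity), ofReal_norm, h3]
  ring

theorem polar_im (R φ : ℝ) : ((R : ℂ) * Complex.exp (φ * Complex.I)).im = R * Real.sin φ := by
  rw [Complex.im_ofReal_mul, Complex.exp_ofReal_mul_I_im]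

theorem norm_polar {R : ℝ} (hR : 0 ≤ R) (φ : ℝ) :
    ‖(R : ℂ) * Complex.exp (φ * Complex.I)‖ = R := by
  rw [norm_mul, Complex.norm_exp_ofReal_mul_I, mul_one, Complex.norm_real, Real.norm_of_nonneg hR]

theorem norm_ofReal_sub_polar_sq (x R φ : ℝ) :
    ‖(x : ℂ) - R * Complex.exp (φ * Complex.I)‖ ^ 2
      = R ^ 2 - 2 * R * x * Real.cos φ + x ^ 2 := by
  rw [← Complex.normSq_eq_norm_sq, Complex.normSq_apply, Complex.sub_re, Complex.sub_im, polar_im,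
    Complex.re_ofReal_mul, Complex.exp_ofReal_mul_I_re, Complex.ofReal_re, Complex.ofReal_im]
  linear_combination R ^ 2 * Real.sin_sq_add_cos_sq φ

/-- Hardy's convexity estimate on the image of the ray `arg w = φ`. -/
theorem lintegral_ray_le {g : ℂ → ℂ} {r : ℝ} (hr : 1 < r)
    (hg : DifferentiableOn ℂ g (Metric.ball 0 r)) {φ : ℝ} (hφ : φ ∈ Set.Ioo 0 Real.pi) :
    ∫⁻ R in Set.Ioi (0 : ℝ),
      ENNReal.ofReal (2 / ‖1 - Complex.I * (R * Complex.exp (φ * Complex.I))‖ ^ 2) *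
        ‖g (cayley (R * Complex.exp (φ * Complex.I)))‖ₑ
      ≤ ENNReal.ofReal (2 * φ) * (∫⁻ x in Set.Iio (0 : ℝ),
          ENNReal.ofReal ((Real.pi * (1 + x ^ 2))⁻¹) * ‖g (cayley x)‖ₑ)
        + ENNReal.ofReal (2 * (Real.pi - φ)) * (∫⁻ x in Set.Ioi (0 : ℝ),
          ENNReal.ofReal ((Real.pi * (1 + x ^ 2))⁻¹) * ‖g (cayley x)‖ₑ) := by
  have hs : 0 < Real.sin φ := Real.sin_pos_of_mem_Ioo hφ
  set k : ℝ → ℝ → ℝ≥0∞ := fun R x =>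
    ENNReal.ofReal (2 * |x| * Real.sin φ / (R ^ 2 - 2 * R * x * Real.cos φ + x ^ 2)) with hk
  set G : ℝ → ℝ≥0∞ := fun x =>
    ENNReal.ofReal ((Real.pi * (1 + x ^ 2))⁻¹) * ‖g (cayley x)‖ₑ with hG
  have hGm : Measurable G := by
    refine Measurable.mul (f := fun x : ℝ => ENNReal.ofReal ((Real.pi * (1 + x ^ 2))⁻¹))
      (by fun_prop) ?_
    apply Continuous.measurable
    apply Continuous.enorm
    refine hg.continuousOn.comp_continuous ?_ ?_
    · exact continuous_iff_continuousAt.mpr fun x =>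
        (hasDerivAt_cayley (w := (x : ℂ)) (by simp)).continuousAt.comp (by fun_prop)
    · intro x
      simpa using (norm_cayley_le_one (w := (x : ℂ)) (by simp)).trans_lt hr
  have hkm : Measurable (Function.uncurry k) := by
    simp only [hk, Function.uncurry_def]
    fun_prop
  have hpt : ∀ R ∈ Set.Ioi (0:ℝ),
      ENNReal.ofReal (2 / ‖1 - Complex.I * (R * Complex.exp (φ * Complex.I))‖ ^ 2) *
        ‖g (cayley (R * Complex.exp (φ * Complex.I)))‖ₑ ≤ ∫⁻ x, k R x * G x := by
    intro R hR
    have hR : 0 < R := hR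
    refine (enorm_cayley_le hr hg (by rw [polar_im]; positivity)).trans_eq ?_
    congr 1 with x
    rw [polar_im, norm_polar hR.le, norm_ofReal_sub_polar_sq, mul_div_cancel_left₀ _ hR.ne']
  refine (setLIntegral_mono_ae' measurableSet_Ioi (ae_of_all _ hpt)).trans ?_
  rw [lintegral_lintegral_swap (by
    apply Measurable.aemeasurable
    exact hkm.mul (hGm.comp measurable_snd))]
  have hin : ∀ x, ∫⁻ R in Set.Ioi (0:ℝ), k R x * G x = (∫⁻ R in Set.Ioi (0:ℝ), k R x) * G x :=
    fun x => lintegral_mul_const _ (hkm.comp (measurable_id.prodMk measurable_const))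
  simp_rw [hin]
  -- The kernel has a different total mass for `x < 0` and for `x > 0`, so the two half-circles are
  -- kept apart.
  rw [← lintegral_add_compl _ (measurableSet_Iio (a := (0:ℝ))), Set.compl_Iio,
    Measure.restrict_congr_set Ioi_ae_eq_Ici.symm,
    ← lintegral_const_mul _ hGm, ← lintegral_const_mul _ hGm]
  refine (congrArg₂ (· + ·) ?_ ?_).le
  · refine setLIntegral_congr_fun measurableSet_Iio fun x hx => ?_
    simp only [hk]
    rw [abs_of_neg hx, lintegral_ray_kernel_neg hφ hx]
  · refine setLIntegral_congr_fun measurableSet_Ioi fun x hx => ?_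
    simp only [hk]
    rw [abs_of_pos hx, lintegral_ray_kernel hφ hx]

theorem continuousOn_comp_cayley {g : ℂ → ℂ} {r : ℝ} (hr : 1 < r)
    (hg : DifferentiableOn ℂ g (Metric.ball 0 r)) :
    ContinuousOn (fun w => g (cayley w)) {w | 0 ≤ w.im} := by
  refine hg.continuousOn.comp (fun w hw => (hasDerivAt_cayley hw).continuousAt.continuousWithinAt)
    fun w hw => ?_
  simpa using (norm_cayley_le_one hw).trans_lt hr

/-! ### Symmetric differences for functions analytic past the unit circle. -/

theorem enorm_sub_le_lintegral_semicircle {F : ℂ → ℂ} {r : ℝ} (hr : 1 < r)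
    (hF : DifferentiableOn ℂ F (Metric.ball 0 r)) {R : ℝ} (hR : 0 < R) :
    ‖F (cayley R) - F (cayley (-R : ℝ))‖ₑ ≤ ENNReal.ofReal R *
      ∫⁻ φ in Set.Ioc 0 Real.pi,
        ENNReal.ofReal (2 / ‖1 - Complex.I * (R * Complex.exp (φ * Complex.I))‖ ^ 2) *
          ‖deriv F (cayley (R * Complex.exp (φ * Complex.I)))‖ₑ := by
  set W : ℝ → ℂ := fun φ => R * Complex.exp (φ * Complex.I) with hW
  have hWc : Continuous W := by fun_prop
  have him : ∀ φ ∈ Set.uIcc 0 Real.pi, 0 ≤ (W φ).im := by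
    intro φ hφ
    rw [Set.uIcc_of_le Real.pi_pos.le] at hφ
    simp only [hW]
    rw [polar_im]
    exact mul_nonneg hR.le (Real.sin_nonneg_of_mem_Icc hφ)
  have hdF := hF.deriv Metric.isOpen_ball
  have hWd : ∀ φ : ℝ, HasDerivAt W (R * (Complex.exp (φ * Complex.I) * Complex.I)) φ := by
    intro φ
    have h1 : HasDerivAt (fun φ : ℝ => (φ : ℂ) * Complex.I) Complex.I φ := by
      simpa using (hasDerivAt_id φ).ofReal_comp.mul_const Complex.I
    exact h1.cexp.const_mul _
  have hd : ∀ φ ∈ Set.uIcc 0 Real.pi, HasDerivAt (fun φ => F (cayley (W φ)))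
      (deriv F (cayley (W φ)) * (2 * Complex.I / (1 - Complex.I * W φ) ^ 2 *
        (R * (Complex.exp (φ * Complex.I) * Complex.I)))) φ := by
    intro φ hφ
    have h1 : HasDerivAt (fun φ => cayley (W φ)) (2 * Complex.I / (1 - Complex.I * W φ) ^ 2 *
        (R * (Complex.exp (φ * Complex.I) * Complex.I))) φ :=
      (hasDerivAt_cayley (him φ hφ)).comp φ (hWd φ)
    have h2 : HasDerivAt F (deriv F (cayley (W φ))) (cayley (W φ)) :=
      (hF.differentiableAt (Metric.isOpen_ball.mem_nhds
        (by simpa using (norm_cayley_le_one (him φ hφ)).trans_lt hr))).hasDerivAt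
    exact h2.comp φ h1
  have hint := intervalIntegral.integral_eq_sub_of_hasDerivAt hd (by
    apply ContinuousOn.intervalIntegrable
    apply ContinuousOn.mul
    · exact (continuousOn_comp_cayley hr hdF).comp hWc.continuousOn him
    · apply ContinuousOn.mul _ (by fun_prop)
      apply ContinuousOn.div (by fun_prop) (by fun_prop)
      exact fun φ hφ => pow_ne_zero _ (one_sub_I_mul_ne_zero (him φ hφ)))
  have hWpi : W Real.pi = (-R : ℝ) := by simp [hW, Complex.exp_pi_mul_I]
  have hW0 : W 0 = R := by simp [hW]
  rw [hWpi, hW0, intervalIntegral.integral_of_le Real.pi_pos.le] at hint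
  rw [← enorm_neg, neg_sub, ← hint, ← lintegral_const_mul' _ _ ENNReal.ofReal_ne_top]
  refine (enorm_integral_le_lintegral_enorm _).trans_eq ?_
  congr 1 with φ
  have h3 : ‖2 * Complex.I / (1 - Complex.I * W φ) ^ 2 *
        (R * (Complex.exp (φ * Complex.I) * Complex.I))‖ₑ
      = ENNReal.ofReal R * ENNReal.ofReal (2 / ‖1 - Complex.I * W φ‖ ^ 2) := by
    rw [← ofReal_norm, ← ENNReal.ofReal_mul hR.le]
    congr 1
    rw [norm_mul, norm_mul (R : ℂ), norm_mul (Complex.exp _), Complex.norm_exp_ofReal_mul_I,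
      Complex.norm_real, Real.norm_of_nonneg hR.le, norm_div, norm_mul, norm_pow, Complex.norm_I,
      Complex.norm_ofNat]
    ring
  rw [enorm_mul, h3]
  ring

theorem lintegral_Ioo_two_mul :
    ∫⁻ φ in Set.Ioo 0 Real.pi, ENNReal.ofReal (2 * φ) = ENNReal.ofReal (Real.pi ^ 2) := by
  have h : ∫ φ in (0:ℝ)..Real.pi, 2 * φ = Real.pi ^ 2 := by
    rw [intervalIntegral.integral_const_mul, integral_id]; ring
  rw [← h, intervalIntegral.integral_of_le Real.pi_pos.le, ofReal_integral_eq_lintegral_ofReal,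
    Measure.restrict_congr_set Ioo_ae_eq_Ioc]
  · exact (Continuous.integrableOn_Ioc (by fun_prop))
  · refine (ae_restrict_iff' measurableSet_Ioc).mpr (ae_of_all _ fun φ hφ => ?_)
    have := hφ.1
    simp only [Pi.zero_apply]; positivity

theorem lintegral_Ioo_two_mul_pi_sub :
    ∫⁻ φ in Set.Ioo 0 Real.pi, ENNReal.ofReal (2 * (Real.pi - φ))
      = ENNReal.ofReal (Real.pi ^ 2) := by
  have h : ∫ φ in (0:ℝ)..Real.pi, 2 * (Real.pi - φ) = Real.pi ^ 2 := by
    rw [intervalIntegral.integral_const_mul,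
      intervalIntegral.integral_sub (by simp) (by simp), integral_id]
    simp; ring
  rw [← h, intervalIntegral.integral_of_le Real.pi_pos.le, ofReal_integral_eq_lintegral_ofReal,
    Measure.restrict_congr_set Ioo_ae_eq_Ioc]
  · exact (Continuous.integrableOn_Ioc (by fun_prop))
  · refine (ae_restrict_iff' measurableSet_Ioc).mpr (ae_of_all _ fun φ hφ => ?_)
    have := hφ.2
    simp only [Pi.zero_apply]; linarith

theorem lintegral_Iio_add_Ioi (u : ℝ → ℝ≥0∞) :
    (∫⁻ x in Set.Iio (0 : ℝ), u x) + ∫⁻ x in Set.Ioi (0 : ℝ), u x = ∫⁻ x, u x := by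
  have h := lintegral_add_compl (μ := volume) u (measurableSet_Iio (a := (0:ℝ)))
  rwa [Set.compl_Iio, Measure.restrict_congr_set Ioi_ae_eq_Ici.symm] at h

/-- Averaging over the angle gives both half-circles the same weight `π²`, so they recombine into
the whole circle. -/
theorem lintegral_rays_le {g : ℂ → ℂ} {r : ℝ} (hr : 1 < r)
    (hg : DifferentiableOn ℂ g (Metric.ball 0 r)) :
    ∫⁻ R in Set.Ioi (0 : ℝ), ∫⁻ φ in Set.Ioc 0 Real.pi,
      ENNReal.ofReal (2 / ‖1 - Complex.I * (R * Complex.exp (φ * Complex.I))‖ ^ 2) *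
        ‖g (cayley (R * Complex.exp (φ * Complex.I)))‖ₑ
      ≤ ENNReal.ofReal (Real.pi ^ 2) *
        ∫⁻ x : ℝ, ENNReal.ofReal ((Real.pi * (1 + x ^ 2))⁻¹) * ‖g (cayley x)‖ₑ := by
  -- The endpoint is dropped because the ray estimate needs `0 < φ < π`.
  simp_rw [Measure.restrict_congr_set (μ := volume) (Ioo_ae_eq_Ioc (a := (0:ℝ)) (b := Real.pi)).symm]
  rw [lintegral_lintegral_swap]
  · refine (setLIntegral_mono_ae' measurableSet_Ioo
      (ae_of_all _ fun φ hφ => lintegral_ray_le hr hg hφ)).trans_eq ?_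
    rw [lintegral_add_left' (by fun_prop), lintegral_mul_const _ (by fun_prop),
      lintegral_mul_const _ (by fun_prop), lintegral_Ioo_two_mul, lintegral_Ioo_two_mul_pi_sub,
      ← mul_add, lintegral_Iio_add_Ioi]
  · rw [Measure.prod_restrict]
    refine AEMeasurable.mul (f := fun p : ℝ × ℝ => ENNReal.ofReal
      (2 / ‖1 - Complex.I * (p.1 * Complex.exp (p.2 * Complex.I))‖ ^ 2))
      (Measurable.aemeasurable ?_) ?_
    · exact Measurable.ennreal_ofReal (Measurable.const_div (Continuous.measurable (by fun_prop)) 2)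
    · refine ContinuousOn.aemeasurable ?_ (measurableSet_Ioi.prod measurableSet_Ioo)
      apply ContinuousOn.enorm
      refine (continuousOn_comp_cayley hr hg).comp
        (f := fun p : ℝ × ℝ => (p.1 : ℂ) * Complex.exp (p.2 * Complex.I))
        (Continuous.continuousOn (by fun_prop)) fun p hp => ?_
      exact (mul_nonneg (le_of_lt hp.1) (Real.sin_pos_of_mem_Ioo hp.2).le).trans_eq
        (polar_im p.1 p.2).symm

theorem norm_one_sub_cayley_ofReal (x : ℝ) : ‖1 - cayley x‖ = 2 * |x| / √(1 + x ^ 2) := by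
  rw [one_sub_cayley (by simp), norm_div, norm_mul, norm_mul, norm_neg, Complex.norm_ofNat,
    Complex.norm_I, Complex.norm_real, Real.norm_eq_abs, ← norm_one_sub_I_mul_ofReal_sq,
    Real.sqrt_sq (norm_nonneg _), mul_one]

theorem lintegral_cayley_symm_diff_le {F : ℂ → ℂ} {r : ℝ} (hr : 1 < r)
    (hF : DifferentiableOn ℂ F (Metric.ball 0 r)) :
    ∫⁻ x : ℝ, ENNReal.ofReal ((Real.pi * (1 + x ^ 2))⁻¹) *
        ENNReal.ofReal (‖F (cayley x) - F (cayley (-x : ℝ))‖ / ‖1 - cayley x‖)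
      ≤ ENNReal.ofReal Real.pi *
        ∫⁻ x : ℝ, ENNReal.ofReal ((Real.pi * (1 + x ^ 2))⁻¹) * ‖deriv F (cayley x)‖ₑ := by
  set u : ℝ → ℝ≥0∞ := fun x => ENNReal.ofReal ((Real.pi * (1 + x ^ 2))⁻¹) *
        ENNReal.ofReal (‖F (cayley x) - F (cayley (-x : ℝ))‖ / ‖1 - cayley x‖) with hu
  have heven : ∀ x, u (-x) = u x := by
    intro x
    simp only [hu]
    rw [norm_one_sub_cayley_ofReal, norm_one_sub_cayley_ofReal, abs_neg, neg_sq, neg_neg,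
      norm_sub_rev]
  have hneg : ∫⁻ x in Set.Iio (0:ℝ), u x = ∫⁻ x in Set.Ioi (0:ℝ), u x := by
    have := (Measure.measurePreserving_neg (volume : Measure ℝ)).setLIntegral_comp_preimage_emb
      (MeasurableEquiv.neg ℝ).measurableEmbedding u (Set.Ioi 0)
    rw [← this]
    simp [heven]
  have hhalf : ∫⁻ x in Set.Ioi (0:ℝ), u x ≤ ENNReal.ofReal (Real.pi / 2) *
        ∫⁻ x : ℝ, ENNReal.ofReal ((Real.pi * (1 + x ^ 2))⁻¹) * ‖deriv F (cayley x)‖ₑ := by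
    have hpt : ∀ R ∈ Set.Ioi (0:ℝ), u R ≤ ENNReal.ofReal ((2 * Real.pi)⁻¹) *
        ∫⁻ φ in Set.Ioc 0 Real.pi,
        ENNReal.ofReal (2 / ‖1 - Complex.I * (R * Complex.exp (φ * Complex.I))‖ ^ 2) *
          ‖deriv F (cayley (R * Complex.exp (φ * Complex.I)))‖ₑ := by
      intro R hR
      have hR : 0 < R := hR
      have h1 := enorm_sub_le_lintegral_semicircle hr hF hR
      have h2 : u R ≤ ENNReal.ofReal ((2 * Real.pi * R)⁻¹) *
          ‖F (cayley R) - F (cayley (-R : ℝ))‖ₑ := by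
        simp only [hu]
        rw [← ofReal_norm, ← ENNReal.ofReal_mul (by positivity),
          ← ENNReal.ofReal_mul (by positivity), norm_one_sub_cayley_ofReal, abs_of_pos hR]
        apply ENNReal.ofReal_le_ofReal
        -- The measure and the denominator together give `1 / (2πR √(1 + R²))`. Discarding the root
        -- leaves a factor whose `1 / R` cancels the `R` of the semicircle's arc length.
        have h3 : (1:ℝ) ≤ √(1 + R ^ 2) := Real.one_le_sqrt.mpr (by nlinarith)
        have h4 : √(1 + R ^ 2) ^ 2 = 1 + R ^ 2 := Real.sq_sqrt (by positivity)
        have h5 : (Real.pi * √(1 + R ^ 2) ^ 2)⁻¹ *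
            (‖F (cayley R) - F (cayley (-R : ℝ))‖ / (2 * R / √(1 + R ^ 2)))
            = (√(1 + R ^ 2))⁻¹ *
              ((2 * Real.pi * R)⁻¹ * ‖F (cayley R) - F (cayley (-R : ℝ))‖) := by
          field_simp
        rw [← h4, Real.sqrt_sq (Real.sqrt_nonneg _), h5]
        exact mul_le_of_le_one_left (by positivity) (inv_le_one_of_one_le₀ h3)
      refine h2.trans ((mul_le_mul_right h1 _).trans_eq ?_)
      rw [← mul_assoc, ← ENNReal.ofReal_mul (by positivity)]
      congr 2
      field_simp
    refine (setLIntegral_mono_ae' measurableSet_Ioi (ae_of_all _ hpt)).trans ?_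
    rw [lintegral_const_mul' _ _ ENNReal.ofReal_ne_top]
    refine (mul_le_mul_right (lintegral_rays_le hr (hF.deriv Metric.isOpen_ball)) _).trans_eq ?_
    rw [← mul_assoc, ← ENNReal.ofReal_mul (by positivity)]
    congr 2
    field_simp
  rw [← lintegral_Iio_add_Ioi u, hneg]
  refine (add_le_add hhalf hhalf).trans_eq ?_
  rw [← add_mul, ← ENNReal.ofReal_add (by positivity) (by positivity), add_halves]

/-! ### The circle measure in the variable `x`, and its rotation invariance. -/

theorem lintegral_circleMeasure {u : Circle → ℝ≥0∞} (hu : Measurable u) :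
    ∫⁻ ζ, u ζ ∂circleMeasure = ENNReal.ofReal (2 * Real.pi)⁻¹ *
      ∫⁻ t in Set.Ioc (-Real.pi) Real.pi, u (Circle.exp t) := by
  rw [circleMeasure, lintegral_map hu Circle.exp.continuous.measurable, lintegral_smul_measure,
    smul_eq_mul]

theorem lintegral_circleMeasure_eq_cayley {u : Circle → ℝ≥0∞} (hu : Measurable u) :
    ∫⁻ ζ, u ζ ∂circleMeasure = ∫⁻ x : ℝ, ENNReal.ofReal ((Real.pi * (1 + x ^ 2))⁻¹) *
      u (Circle.exp (2 * Real.arctan x)) := by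
  rw [lintegral_circleMeasure hu, Measure.restrict_congr_set Ioo_ae_eq_Ioc.symm,
    lintegral_Ioo_eq_lintegral_arctan, ← lintegral_const_mul' _ _ ENNReal.ofReal_ne_top]
  congr 1 with x
  rw [← mul_assoc, ← ENNReal.ofReal_mul (by positivity)]
  congr 2
  field_simp

theorem coe_exp_two_arctan (x : ℝ) : (Circle.exp (2 * Real.arctan x) : ℂ) = cayley x := by
  rw [Circle.coe_exp, exp_two_arctan]

theorem coe_inv_exp_two_arctan (x : ℝ) :
    (((Circle.exp (2 * Real.arctan x))⁻¹ : Circle) : ℂ) = cayley (-x : ℝ) := by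
  rw [← Circle.exp_neg, ← coe_exp_two_arctan, Real.arctan_neg, mul_neg]

/-- A rotation shifts the parameter, and a `2π`-periodic function has the same integral over every
period. -/
theorem lintegral_circleMeasure_mul_right {v : Circle → ℝ} (hv : Continuous v)
    (hv0 : ∀ ζ, 0 ≤ v ζ) (η : Circle) :
    ∫⁻ ζ, ENNReal.ofReal (v (ζ * η)) ∂circleMeasure
      = ∫⁻ ζ, ENNReal.ofReal (v ζ) ∂circleMeasure := by
  have key : ∀ s : ℝ, ∫⁻ t in Set.Ioc (-Real.pi) Real.pi, ENNReal.ofReal (v (Circle.exp (t + s)))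
      = ENNReal.ofReal (∫ t in (-Real.pi + s)..(Real.pi + s), v (Circle.exp t)) := by
    intro s
    rw [← intervalIntegral.integral_comp_add_right (fun t => v (Circle.exp t)),
      intervalIntegral.integral_of_le (by linarith [Real.pi_pos]),
      ofReal_integral_eq_lintegral_ofReal _ (ae_of_all _ fun t => hv0 _)]
    exact Continuous.integrableOn_Ioc (by fun_prop)
  have hper : Function.Periodic (fun t => v (Circle.exp t)) (2 * Real.pi) := fun t => by
    simp only [Circle.periodic_exp t]
  obtain ⟨s, rfl⟩ : ∃ s, Circle.exp s = η := ⟨_, Circle.exp_arg η⟩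
  rw [lintegral_circleMeasure (by fun_prop), lintegral_circleMeasure (by fun_prop)]
  simp_rw [← Circle.exp_add]
  have h0 := key 0
  simp only [add_zero] at h0
  have h1 := hper.intervalIntegral_add_eq (-Real.pi + s) (-Real.pi)
  rw [key s, h0]
  congr 2
  convert h1 using 2 <;> ring

/-! ### Dilations, the Fejér–Riesz inequality and radial limits. -/

section Dilation

variable {f : ℂ → ℂ}

theorem differentiableOn_dilation {g : ℂ → ℂ} (hg : DifferentiableOn ℂ g (Metric.ball 0 1)) {ρ : ℝ}
    (hρ : ρ ∈ Set.Ioo 0 1) (η : Circle) :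
    DifferentiableOn ℂ (fun z => g (ρ * (z * η))) (Metric.ball 0 ρ⁻¹) := by
  refine hg.comp (by fun_prop) fun z hz => ?_
  rw [mem_ball_zero_iff] at hz ⊢
  rw [norm_mul, norm_mul, Circle.norm_coe, mul_one, Complex.norm_real, Real.norm_of_nonneg hρ.1.le]
  calc ρ * ‖z‖ < ρ * ρ⁻¹ := mul_lt_mul_of_pos_left hz hρ.1
    _ = 1 := mul_inv_cancel₀ hρ.1.ne'

theorem mem_ball_dilation {ρ : ℝ} (hρ : ρ ∈ Set.Ioo 0 1) (ζ : Circle) :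
    (ρ : ℂ) * ζ ∈ Metric.ball (0 : ℂ) 1 := by
  rw [mem_ball_zero_iff, norm_mul, Circle.norm_coe, mul_one, Complex.norm_real,
    Real.norm_of_nonneg hρ.1.le]
  exact hρ.2

theorem continuous_dilation {g : ℂ → ℂ} (hg : DifferentiableOn ℂ g (Metric.ball 0 1)) {ρ : ℝ}
    (hρ : ρ ∈ Set.Ioo 0 1) : Continuous fun ζ : Circle => g (ρ * ζ) :=
  hg.continuousOn.comp_continuous (by fun_prop) (mem_ball_dilation hρ)

theorem lintegral_cayley_dilation_le {g : ℂ → ℂ} (hg : DifferentiableOn ℂ g (Metric.ball 0 1))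
    {ρ : ℝ} (hρ : ρ ∈ Set.Ioo 0 1) (η : Circle) :
    ∫⁻ x : ℝ, ENNReal.ofReal ((Real.pi * (1 + x ^ 2))⁻¹) * ‖g (ρ * (cayley x * η))‖ₑ
      ≤ hardyOneNorm g := by
  have hc := continuous_dilation hg hρ
  have h1 := lintegral_circleMeasure_eq_cayley (u := fun ζ => ‖g (ρ * ((ζ * η : Circle) : ℂ))‖ₑ)
    (Continuous.measurable (hc.comp (continuous_mul_const η)).enorm)
  simp only [Circle.coe_mul, coe_exp_two_arctan] at h1
  rw [← h1]
  have h2 := lintegral_circleMeasure_mul_right hc.norm (fun _ => norm_nonneg _) η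
  simp only [ofReal_norm, Circle.coe_mul] at h2
  rw [h2]
  exact le_iSup₂ (f := fun r (_ : r ∈ Set.Ico (0:ℝ) 1) =>
    ∫⁻ ζ : Circle, ‖g ((r : ℂ) * (ζ : ℂ))‖ₑ ∂circleMeasure) ρ ⟨hρ.1.le, hρ.2⟩

theorem lintegral_dilation_symm_diff_le (hf : DifferentiableOn ℂ f (Metric.ball 0 1)) {ρ : ℝ}
    (hρ : ρ ∈ Set.Ioo 0 1) (η : Circle) :
    ∫⁻ ζ : Circle, ENNReal.ofReal (‖f (ρ * (ζ * η : Circle)) - f (ρ * (ζ⁻¹ * η : Circle))‖ /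
      ‖1 - (ζ : ℂ)‖) ∂circleMeasure ≤ ENNReal.ofReal Real.pi * hardyOneNorm (deriv f) := by
  have hc := continuous_dilation hf hρ
  have hm : Measurable fun ζ : Circle => ENNReal.ofReal
      (‖f (ρ * (ζ * η : Circle)) - f (ρ * (ζ⁻¹ * η : Circle))‖ / ‖1 - (ζ : ℂ)‖) := by
    refine (Measurable.div (Continuous.measurable ?_)
      (Continuous.measurable (by fun_prop))).ennreal_ofReal
    exact ((hc.comp (continuous_mul_const η)).sub
      (hc.comp (continuous_inv.mul continuous_const))).norm
  rw [lintegral_circleMeasure_eq_cayley hm]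
  simp only [Circle.coe_mul, coe_exp_two_arctan, coe_inv_exp_two_arctan]
  have hr : 1 < ρ⁻¹ := (one_lt_inv₀ hρ.1).mpr hρ.2
  refine (lintegral_cayley_symm_diff_le hr (differentiableOn_dilation hf hρ η)).trans ?_
  refine mul_le_mul_right (le_trans (lintegral_mono fun x => mul_le_mul_right ?_ _)
    (lintegral_cayley_dilation_le (hf.deriv Metric.isOpen_ball) hρ η)) _
  have hmem : (ρ : ℂ) * (cayley x * η) ∈ Metric.ball (0 : ℂ) 1 := by
    rw [← coe_exp_two_arctan, ← Circle.coe_mul]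
    exact mem_ball_dilation hρ _
  have h1 : HasDerivAt (fun z : ℂ => (ρ : ℂ) * (z * η)) (ρ * η) (cayley x) := by
    simpa using ((hasDerivAt_id (cayley x)).mul_const (η : ℂ)).const_mul (ρ : ℂ)
  have h2 : HasDerivAt f (deriv f (ρ * (cayley x * η))) (ρ * (cayley x * η)) :=
    (hf.differentiableAt (Metric.isOpen_ball.mem_nhds hmem)).hasDerivAt
  have h3 : deriv (fun z : ℂ => f (ρ * (z * η))) (cayley x)
      = deriv f (ρ * (cayley x * η)) * (ρ * η) := (h2.comp (cayley x) h1).deriv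
  rw [h3, ← ofReal_norm, ← ofReal_norm]
  apply ENNReal.ofReal_le_ofReal
  rw [norm_mul, norm_mul, Circle.norm_coe, mul_one, Complex.norm_real, Real.norm_of_nonneg hρ.1.le]
  -- The chain rule contributes the factor `ρη`, of modulus at most 1.
  exact mul_le_of_le_one_right (norm_nonneg _) hρ.2.le

/-- Fatou's lemma, in the form used for each limit `ρ → 1`. -/
theorem lintegral_le_of_tendsto_of_le {α : Type*} [MeasurableSpace α] {μ : Measure α}
    {u : ℕ → α → ℝ≥0∞} {v : α → ℝ≥0∞} {C : ℝ≥0∞} (hu : ∀ n, AEMeasurable (u n) μ)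
    (hlim : ∀ᵐ a ∂μ, Tendsto (fun n => u n a) atTop (𝓝 (v a))) (hC : ∀ n, ∫⁻ a, u n a ∂μ ≤ C) :
    ∫⁻ a, v a ∂μ ≤ C := by
  calc ∫⁻ a, v a ∂μ = ∫⁻ a, liminf (fun n => u n a) atTop ∂μ :=
        lintegral_congr_ae (hlim.mono fun a ha => ha.liminf_eq.symm)
    _ ≤ liminf (fun n => ∫⁻ a, u n a ∂μ) atTop := lintegral_liminf_le' hu
    _ ≤ C := liminf_le_of_frequently_le' (Frequently.of_forall hC)

theorem exists_seq_tendsto_one :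
    ∃ ρ : ℕ → ℝ, (∀ n, ρ n ∈ Set.Ioo 0 1) ∧ Tendsto ρ atTop (𝓝[<] 1) := by
  obtain ⟨ρ, -, h1, h2⟩ := exists_seq_strictMono_tendsto' (zero_lt_one (α := ℝ))
  exact ⟨ρ, h1, tendsto_nhdsWithin_iff.mpr ⟨h2, Eventually.of_forall fun n => (h1 n).2⟩⟩

theorem cayley_mul_I (R : ℝ) : cayley (R * Complex.I) = ((1 - R) / (1 + R) : ℝ) := by
  have h : Complex.I * (R * Complex.I) = -R := by linear_combination (R : ℂ) * Complex.I_sq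
  rw [cayley, h]
  push_cast
  ring

/-- The Fejér–Riesz inequality along a diameter, parametrized by `x = (R - 1) / (R + 1)`. -/
theorem lintegral_diameter_le {g : ℂ → ℂ} (hg : DifferentiableOn ℂ g (Metric.ball 0 1))
    (η : Circle) :
    ∫⁻ R in Set.Ioi (0 : ℝ), ENNReal.ofReal (2 / (1 + R) ^ 2) *
      ‖g (((R - 1) / (R + 1) : ℝ) * η)‖ₑ ≤ ENNReal.ofReal Real.pi * hardyOneNorm g := by
  obtain ⟨ρ, hρ, hρ1⟩ := exists_seq_tendsto_one
  have hmem : ∀ R ∈ Set.Ioi (0:ℝ), |(R - 1) / (R + 1)| < 1 := by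
    intro R hR
    have hR : 0 < R := hR
    rw [abs_div, abs_of_pos (by linarith : 0 < R + 1), div_lt_one (by linarith), abs_lt]
    constructor <;> linarith
  have hball : ∀ R ∈ Set.Ioi (0:ℝ), ∀ s ∈ Set.Ioc (0:ℝ) 1,
      (s : ℂ) * (((R - 1) / (R + 1) : ℝ) * η) ∈ Metric.ball (0:ℂ) 1 := by
    intro R hR s hs
    rw [mem_ball_zero_iff, norm_mul, norm_mul, Circle.norm_coe, mul_one, Complex.norm_real,
      Complex.norm_real, Real.norm_of_nonneg hs.1.le, Real.norm_eq_abs]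
    exact (mul_le_of_le_one_left (abs_nonneg _) hs.2).trans_lt (hmem R hR)
  refine lintegral_le_of_tendsto_of_le
    (u := fun n R => ENNReal.ofReal (2 / (1 + R) ^ 2) *
      ‖g (ρ n * (((R - 1) / (R + 1) : ℝ) * η))‖ₑ) (fun n => ?_) ?_ fun n => ?_
  · refine AEMeasurable.mul (f := fun R : ℝ => ENNReal.ofReal (2 / (1 + R) ^ 2))
      (by fun_prop) ?_
    refine ContinuousOn.aemeasurable ?_ measurableSet_Ioi
    refine (hg.continuousOn.comp ?_ fun R hR => hball R hR _ ⟨(hρ n).1, (hρ n).2.le⟩).enorm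
    refine continuousOn_const.mul (ContinuousOn.mul ?_ continuousOn_const)
    refine Complex.continuous_ofReal.comp_continuousOn (ContinuousOn.div (by fun_prop)
      (by fun_prop) fun R hR => ?_)
    have hR : 0 < R := hR
    positivity
  · refine (ae_restrict_iff' measurableSet_Ioi).mpr (ae_of_all _ fun R hR => ?_)
    refine ENNReal.Tendsto.const_mul ?_ (Or.inr ENNReal.ofReal_ne_top)
    refine Tendsto.enorm ?_
    have h1 := hball R hR 1 ⟨one_pos, le_rfl⟩
    rw [Complex.ofReal_one, one_mul] at h1
    refine (hg.continuousOn.continuousAt (Metric.isOpen_ball.mem_nhds h1)).tendsto.comp ?_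
    have h2 : Tendsto (fun n => (ρ n : ℂ)) atTop (𝓝 ((1:ℝ) : ℂ)) :=
      (Complex.continuous_ofReal.tendsto 1).comp (hρ1.mono_right nhdsWithin_le_nhds)
    simpa using h2.mul_const ((((R - 1) / (R + 1) : ℝ) : ℂ) * η)
  · have hr : 1 < (ρ n)⁻¹ := (one_lt_inv₀ (hρ n).1).mpr (hρ n).2
    -- At `φ = π/2` both angular constants equal `π`. Since `cayley (iR)` runs from 1 to -1 as `R`
    -- grows, the rotation by `Circle.exp π = -1` makes the diameter end at `η`.
    have h1 := lintegral_ray_le hr (differentiableOn_dilation hg (hρ n) (η * Circle.exp Real.pi))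
      (φ := Real.pi / 2) ⟨by positivity, by linarith [Real.pi_pos]⟩
    have h2 := lintegral_cayley_dilation_le hg (hρ n) (η * Circle.exp Real.pi)
    rw [show 2 * (Real.pi - Real.pi / 2) = Real.pi by ring, mul_div_cancel₀ _ two_ne_zero, ← mul_add,
      lintegral_Iio_add_Ioi] at h1
    refine le_trans (le_of_eq ?_) (h1.trans (mul_le_mul_right h2 _))
    refine setLIntegral_congr_fun measurableSet_Ioi fun R hR => ?_
    have hR : 0 < R := hR
    have h3 : Complex.exp ((Real.pi / 2 : ℝ) * Complex.I) = Complex.I := by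
      push_cast; exact Complex.exp_pi_div_two_mul_I
    have h4 : 1 - Complex.I * (R * Complex.I) = (1 + R : ℝ) := by
      push_cast; linear_combination (-(R : ℂ)) * Complex.I_sq
    have h5 : (((R - 1) / (R + 1) : ℝ) : ℂ) * η
        = ((1 - R) / (1 + R) : ℝ) * (η * Circle.exp Real.pi : Circle) := by
      rw [Circle.coe_mul, Circle.coe_exp, Complex.exp_pi_mul_I, mul_neg_one, mul_neg, ← neg_mul,
        ← Complex.ofReal_neg, ← neg_div, neg_sub, add_comm]
    simp only [h3, h4, cayley_mul_I, Complex.norm_real, Real.norm_eq_abs, sq_abs, h5]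

/-- The derivative along the diameter through `ξ` is integrable by Fejér–Riesz, which holds for
every direction; hence the limit exists at every `ξ`, not merely almost everywhere. -/
theorem exists_tendsto_radial (hf : DifferentiableOn ℂ f (Metric.ball 0 1))
    (hf' : hardyOneNorm (deriv f) < ∞) (ξ : Circle) :
    ∃ L, Tendsto (fun r : ℝ => f ((r : ℂ) * (ξ : ℂ))) (𝓝[<] (1 : ℝ)) (𝓝 L) := by
  have hdf := hf.deriv Metric.isOpen_ball
  set q : ℝ → ℂ := fun R => f (((R - 1) / (R + 1) : ℝ) * ξ) with hq
  set q' : ℝ → ℂ := fun R => deriv f (((R - 1) / (R + 1) : ℝ) * ξ) *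
    ((2 / (1 + R) ^ 2 : ℝ) * ξ) with hq'
  have hball : ∀ R ∈ Set.Ioi (0:ℝ), (((R - 1) / (R + 1) : ℝ) * ξ : ℂ) ∈ Metric.ball (0:ℂ) 1 := by
    intro R hR
    have hR : 0 < R := hR
    rw [mem_ball_zero_iff, norm_mul, Circle.norm_coe, mul_one, Complex.norm_real, Real.norm_eq_abs,
      abs_div, abs_of_pos (by linarith : 0 < R + 1), div_lt_one (by linarith), abs_lt]
    constructor <;> linarith
  have hder : ∀ R ∈ Set.Ioi (0:ℝ), HasDerivAt q (q' R) R := by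
    intro R hR
    have hR0 : R + 1 ≠ 0 := by have hR : 0 < R := hR; positivity
    have h1 : HasDerivAt (fun R : ℝ => (R - 1) / (R + 1)) (2 / (1 + R) ^ 2) R := by
      refine (((hasDerivAt_id R).sub_const 1).div ((hasDerivAt_id R).add_const 1)
        hR0).congr_deriv ?_
      simp only [id]
      rw [add_comm 1 R]
      congr 1
      ring
    exact (hf.differentiableAt (Metric.isOpen_ball.mem_nhds (hball R hR))).hasDerivAt.comp R
      (h1.ofReal_comp.mul_const (ξ : ℂ))
  have hint : IntegrableOn q' (Set.Ioi 0) := by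
    refine ⟨ContinuousOn.aestronglyMeasurable ?_ measurableSet_Ioi, ?_⟩
    · have hpos : ∀ R ∈ Set.Ioi (0:ℝ), 0 < R := fun R hR => hR
      refine (hdf.continuousOn.comp ?_ hball).mul ?_
      · refine (Complex.continuous_ofReal.comp_continuousOn (ContinuousOn.div (by fun_prop)
          (by fun_prop) fun R hR => ?_)).mul continuousOn_const
        have := hpos R hR
        positivity
      · refine (Complex.continuous_ofReal.comp_continuousOn (ContinuousOn.div (by fun_prop)
          (by fun_prop) fun R hR => ?_)).mul continuousOn_const
        have := hpos R hR
        positivity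
    · refine lt_of_le_of_lt (le_of_eq ?_) ((lintegral_diameter_le hdf ξ).trans_lt
        (ENNReal.mul_lt_top ENNReal.ofReal_lt_top hf'))
      congr 1 with R
      rw [hq', enorm_mul, enorm_mul, ← ofReal_norm (ξ : ℂ), Circle.norm_coe, ENNReal.ofReal_one,
        mul_one, ← ofReal_norm (((2 / (1 + R) ^ 2 : ℝ)) : ℂ), Complex.norm_real,
        Real.norm_of_nonneg (by positivity), mul_comm]
  have hlim := tendsto_limUnder_of_hasDerivAt_of_integrableOn_Ioi hder hint
  -- `R = (1 + r) / (1 - r)` inverts `r = (R - 1) / (R + 1)` and tends to infinity as `r → 1-`.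
  refine ⟨_, (hlim.comp (g := q) (f := fun r : ℝ => (1 + r) / (1 - r)) ?_).congr' ?_⟩
  · have h1 : Tendsto (fun r : ℝ => 1 - r) (𝓝[<] 1) (𝓝[>] 0) := by
      refine tendsto_nhdsWithin_iff.mpr ⟨?_, ?_⟩
      · exact tendsto_nhdsWithin_of_tendsto_nhds (Continuous.tendsto' (by fun_prop) _ _ (by simp))
      · filter_upwards [self_mem_nhdsWithin] with r hr
        exact sub_pos.mpr (Set.mem_Iio.mp hr)
    have h2 : Tendsto (fun r : ℝ => 1 + r) (𝓝[<] 1) (𝓝 2) :=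
      tendsto_nhdsWithin_of_tendsto_nhds (Continuous.tendsto' (by fun_prop) _ _ (by norm_num))
    exact h2.pos_mul_atTop two_pos (tendsto_inv_nhdsGT_zero.comp h1)
  · filter_upwards [self_mem_nhdsWithin] with r hr
    have hr : 1 - r ≠ 0 := (sub_pos.mpr (Set.mem_Iio.mp hr)).ne'
    have h1 : ((1 + r) / (1 - r) - 1) / ((1 + r) / (1 - r) + 1) = r := by
      field_simp
      ring
    simp only [Function.comp, hq, h1]

end Dilation

/-! ### Passage to the boundary values. -/

theorem theorem1 (f : ℂ → ℂ) (hf : AnalyticOnNhd ℂ f (Metric.ball 0 1))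
    (hf' : MemHardyOne (deriv f)) :
    (∀ ξ : Circle,
      Tendsto (fun r : ℝ => f ((r : ℂ) * (ξ : ℂ))) (𝓝[<] (1 : ℝ)) (𝓝 (radialLimit f ξ))) ∧
    ∀ η : Circle,
      Integrable (fun ζ : Circle =>
        ‖radialLimit f (ζ * η) - radialLimit f (ζ⁻¹ * η)‖ / ‖1 - (ζ : ℂ)‖) circleMeasure ∧
      ∫ ζ : Circle,
        ‖radialLimit f (ζ * η) - radialLimit f (ζ⁻¹ * η)‖ / ‖1 - (ζ : ℂ)‖ ∂circleMeasure
        ≤ Real.pi * (hardyOneNorm (deriv f)).toReal := by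
  have hd : DifferentiableOn ℂ f (Metric.ball 0 1) := hf.differentiableOn
  have hrad : ∀ ξ : Circle,
      Tendsto (fun r : ℝ => f ((r : ℂ) * (ξ : ℂ))) (𝓝[<] (1 : ℝ)) (𝓝 (radialLimit f ξ)) :=
    fun ξ => tendsto_nhds_limUnder (exists_tendsto_radial hd hf'.2 ξ)
  refine ⟨hrad, fun η => ?_⟩
  obtain ⟨ρ, hρ, hρ1⟩ := exists_seq_tendsto_one
  have hmeas : Measurable (radialLimit f) :=
    measurable_of_tendsto_metrizable (fun n => (continuous_dilation hd (hρ n)).measurable)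
      (tendsto_pi_nhds.mpr fun ξ => (hrad ξ).comp hρ1)
  have hsym : Measurable fun ζ : Circle =>
      ‖radialLimit f (ζ * η) - radialLimit f (ζ⁻¹ * η)‖ := by
    have h1 : Measurable fun ζ : Circle => ζ * η := Continuous.measurable (by fun_prop)
    have h2 : Measurable fun ζ : Circle => ζ⁻¹ * η := Continuous.measurable (by fun_prop)
    exact ((hmeas.comp h1).sub (hmeas.comp h2)).norm
  have hden : Measurable fun ζ : Circle => ‖1 - (ζ : ℂ)‖ := Continuous.measurable (by fun_prop)
  have hm := hsym.div hden
  have hle : ∫⁻ ζ : Circle, ENNReal.ofReal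
      (‖radialLimit f (ζ * η) - radialLimit f (ζ⁻¹ * η)‖ / ‖1 - (ζ : ℂ)‖) ∂circleMeasure
      ≤ ENNReal.ofReal Real.pi * hardyOneNorm (deriv f) := by
    refine lintegral_le_of_tendsto_of_le (u := fun n (ζ : Circle) => ENNReal.ofReal
      (‖f (ρ n * (ζ * η : Circle)) - f (ρ n * (ζ⁻¹ * η : Circle))‖ / ‖1 - (ζ : ℂ)‖))
      (fun n => ?_) (ae_of_all _ fun ζ => ?_)
      fun n => lintegral_dilation_symm_diff_le hd (hρ n) η
    · have hc := continuous_dilation hd (hρ n)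
      refine (Measurable.div (Continuous.measurable ?_) hden).ennreal_ofReal.aemeasurable
      exact ((hc.comp (continuous_mul_const η)).sub
        (hc.comp (continuous_inv.mul continuous_const))).norm
    -- The point `ζ = 1` needs no exception: division by zero gives 0 for every `n` and in the
    -- limit.
    · exact ENNReal.tendsto_ofReal
        ((((hrad _).comp hρ1).sub ((hrad _).comp hρ1)).norm.div_const _)
  have hfin : ENNReal.ofReal Real.pi * hardyOneNorm (deriv f) < ∞ :=
    ENNReal.mul_lt_top ENNReal.ofReal_lt_top hf'.2
  have hnn : ∀ᵐ ζ : Circle ∂circleMeasure,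
      0 ≤ ‖radialLimit f (ζ * η) - radialLimit f (ζ⁻¹ * η)‖ / ‖1 - (ζ : ℂ)‖ :=
    ae_of_all _ fun ζ => by positivity
  refine ⟨⟨hm.aestronglyMeasurable, (hasFiniteIntegral_iff_ofReal hnn).mpr (hle.trans_lt hfin)⟩, ?_⟩
  rw [integral_eq_lintegral_of_nonneg_ae hnn hm.aestronglyMeasurable]
  refine (ENNReal.toReal_mono hfin.ne hle).trans_eq ?_
  rw [ENNReal.toReal_mul, ENNReal.toReal_ofReal Real.pi_pos.le]
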